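/- Let $X$ and $Y$ be random vectors with values in $\mathbb{R}^{n_x}$ and $\mathbb{R}^{n_y}$, defined on a common probability space, with $\mathbb{E}\|X\|^2<\infty$ and an otherwise arbitrary joint law $p_{XY}$. An estimator $\hat X$ of $X$ from $Y$ is given by a conditional distribution (Markov kernel) $p_{\hat X|Y}$ from $\mathbb{R}^{n_y}$ to $\mathbb{R}^{n_x}$, with $\hat X$ conditionally independent of $X$ given $Y$; its distortion is $\mathbb{E}\|X-\hat X\|^2$ and its perception index is $W_2(p_X,p_{\hat X})$, where $p_{\hat X}$ is the law of $\hat X$ induced by $p_{\hat X|Y}$ and $p_Y$, and $$W_2(\mu,\gamma)=\Big(\inf\big\{\mathbb{E}_{(U,V)\sim\nu}\|U-V\|^2 : \nu \text{ a probability measure on } \mathbb{R}^{n_x}\times\mathbb{R}^{n_x} \text{ with marginals } \mu,\gamma\big\}\Big)^{1/2}.$$ For $P\ge 0$ define the distortion-perception function $$D(P)=\inf_{p_{\hat X|Y}}\big\{\mathbb{E}\|X-\hat X\|^2 : W_2(p_X,p_{\hat X})\le P\big\},$$ and let $X^*=\mathbb{E}[X|Y]$, $D^*=\mathbb{E}\|X-X^*\|^2$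 and $P^*=W_2(p_X,p_{X^*})$. Then, for every $P\ge 0$, the quantities $D^*$, $P^*$ and $D(P)$ are finite and $$D(P)=D^*+\big[(P^*-P)_+\big]^2,\qquad (x)_+=\max(0,x).$$ Furthermore, the infimum is attained by an estimator obtained by applying a (possibly stochastic) transformation to $X^*$: there is a Markov kernel $\kappa$ from $\mathbb{R}^{n_x}$ to $\mathbb{R}^{n_x}$ and an estimator $p_{\hat X|Y}$ with $p_{\hat X|Y}(\cdot\,|\,Y)=\kappa(\cdot\,|\,X^*)$ almost surely, whose distortion equals $D(P)$ and whose perception index equals $\min(P,P^*)$ (that is, exactly $P$ when $P\le P^*$). -/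

import Mathlib

open MeasureTheory ProbabilityTheory
open scoped ENNReal

namespace DistortionPerception

noncomputable section

/-- The Euclidean space `ℝⁿ`. -/
abbrev Vec (n : ℕ) : Type := EuclideanSpace ℝ (Fin n)

/-- `Π(μ, γ)`: the probability measures on the product with marginals `μ` and `γ`. -/
def couplings {n : ℕ} (μ γ : Measure (Vec n)) : Set (Measure (Vec n × Vec n)) :=
  {ν | IsProbabilityMeasure ν ∧ ν.fst = μ ∧ ν.snd = γ}

/-- The Wasserstein-2 distance, with values in `[0, ∞]`. -/
def W2 {n : ℕ} (μ γ : Measure (Vec n)) : ℝ≥0∞ :=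
  (⨅ ν ∈ couplings μ γ, ∫⁻ z, ‖z.1 - z.2‖ₑ ^ 2 ∂ν) ^ (1 / 2 : ℝ)

variable {Ω : Type*} [MeasurableSpace Ω] {nx ny : ℕ}

/-- An estimator is a conditional law `p_{X̂|Y}`, i.e. a Markov kernel `K` from the space of `Y` to
the space of `X`. This is the resulting joint law of `((X, Y), X̂)`, in which `X̂` is
independent of `X` given `Y`. -/
def jointLaw (ρ : Measure Ω) (X : Ω → Vec nx) (Y : Ω → Vec ny) (K : Kernel (Vec ny) (Vec nx)) :
    Measure ((Vec nx × Vec ny) × Vec nx) :=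
  (ρ.map fun ω ↦ (X ω, Y ω)) ⊗ₘ Kernel.prodMkLeft (Vec nx) K

/-- The mean squared error `E ‖X - X̂‖²` of the estimator `K`. -/
def mse (ρ : Measure Ω) (X : Ω → Vec nx) (Y : Ω → Vec ny) (K : Kernel (Vec ny) (Vec nx)) :
    ℝ≥0∞ :=
  ∫⁻ z, ‖z.1.1 - z.2‖ₑ ^ 2 ∂(jointLaw ρ X Y K)

/-- The perception index `W₂(p_X, p_X̂)` of the estimator `K`, where `p_X̂` is the law induced by
`K` and `p_Y`. -/
def perceptionIndex (ρ : Measure Ω) (X : Ω → Vec nx) (Y : Ω → Vec ny)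
    (K : Kernel (Vec ny) (Vec nx)) : ℝ≥0∞ :=
  W2 (ρ.map X) (K ∘ₘ (ρ.map Y))

/-- The distortion-perception function `D(P)`, with values in `[0, ∞]`. -/
def dpFunction (ρ : Measure Ω) (X : Ω → Vec nx) (Y : Ω → Vec ny) (P : ℝ) : ℝ≥0∞ :=
  ⨅ (K : Kernel (Vec ny) (Vec nx)) (_ : IsMarkovKernel K)
    (_ : perceptionIndex ρ X Y K ≤ ENNReal.ofReal P), mse ρ X Y K

/-- `X* = E[X | Y]`. -/
def xStar (ρ : Measure Ω) (X : Ω → Vec nx) (Y : Ω → Vec ny) : Ω → Vec nx :=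
  ρ[X | MeasurableSpace.comap Y inferInstance]

/-- `D* = E ‖X - X*‖²`. -/
def dStar (ρ : Measure Ω) (X : Ω → Vec nx) (Y : Ω → Vec ny) : ℝ≥0∞ :=
  ∫⁻ ω, ‖X ω - xStar ρ X Y ω‖ₑ ^ 2 ∂ρ

/-- `P* = W₂(p_X, p_{X*})`. -/
def pStar (ρ : Measure Ω) (X : Ω → Vec nx) (Y : Ω → Vec ny) : ℝ≥0∞ :=
  W2 (ρ.map X) (ρ.map (xStar ρ X Y))

end

end DistortionPerception

open DistortionPerception

/-! ### Second moments, kernels and weak lower semicontinuity -/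

namespace MeasureTheory

/-! Given `Y`, the estimate `X̂` is independent of `X`, so `X - X*` is orthogonal to every
square-integrable function of `(Y, X̂)`. Hence the distortion is `D* + E‖X* - X̂‖²`
(`mse_eq_dStar_add`), and only the second term depends on the estimator.

Lower bound: `E‖X* - X̂‖²` is at least `W₂(p_{X*}, p_X̂)²`, and the triangle inequality for `W₂`
bounds this distance below by `P*` minus the perception index (`dStar_add_sq_le_mse`).

Attainment: take an optimal coupling of `X*` with a copy `X'` of `X` and set `X̂ = X* + s(X' - X*)`.
This costs `(s P*)²` and leaves perception index `(1 - s) P*` (`exists_kernel_interpolation`);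
choose `s` with `s P* = (P* - P)₊`. Optimal couplings exist by weak compactness; the triangle
inequality follows by gluing them. -/

lemma eLpNorm_two_eq_lintegral_sq_rpow {α E : Type*} {mα : MeasurableSpace α}
    [NormedAddCommGroup E] (f : α → E) (μ : Measure α) :
    eLpNorm f 2 μ = (∫⁻ x, ‖f x‖ₑ ^ 2 ∂μ) ^ (1 / 2 : ℝ) := by
  rw [eLpNorm_eq_lintegral_rpow_enorm_toReal two_ne_zero ENNReal.ofNat_ne_top]
  simp

lemma lintegral_sq_enorm_eq_eLpNorm_sq {α E : Type*} {mα : MeasurableSpace α}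
    [NormedAddCommGroup E] (f : α → E) (μ : Measure α) :
    ∫⁻ x, ‖f x‖ₑ ^ 2 ∂μ = eLpNorm f 2 μ ^ 2 := by
  rw [eLpNorm_two_eq_lintegral_sq_rpow, ← ENNReal.rpow_natCast, ← ENNReal.rpow_mul]
  simp

/-- Used to glue couplings, to forget `X` in the joint law, and to pass from `Y` to `X*`. -/
lemma Measure.map_prodMap_compProd_comap {α β γ : Type*} {mα : MeasurableSpace α}
    {mβ : MeasurableSpace β} {mγ : MeasurableSpace γ} (μ : Measure α) [SFinite μ]
    {f : α → β} (hf : Measurable f) (κ : Kernel β γ) [IsSFiniteKernel κ] :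
    (μ ⊗ₘ κ.comap f hf).map (Prod.map f id) = μ.map f ⊗ₘ κ := by
  refine Measure.ext_of_lintegral _ fun h hh ↦ ?_
  rw [lintegral_map hh (by fun_prop), Measure.lintegral_compProd (by fun_prop),
    Measure.lintegral_compProd hh, lintegral_map (by fun_prop) hf]
  simp

/-- Integration of a nonnegative continuous function is lower semicontinuous for the weak
topology. -/
lemma ProbabilityMeasure.lowerSemicontinuous_lintegral {α : Type*} [MeasurableSpace α]
    [TopologicalSpace α] [OpensMeasurableSpace α] {f : α → NNReal} (hf : Continuous f) :
    LowerSemicontinuous fun ν : ProbabilityMeasure α ↦ ∫⁻ x, f x ∂(ν : Measure α) := by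
  -- The truncations `min f n` are bounded and continuous, so their integrals are weakly continuous;
  -- a supremum of continuous functions is lower semicontinuous.
  have key (ν : ProbabilityMeasure α) : ∫⁻ x, f x ∂(ν : Measure α) =
      ⨆ n : ℕ, ∫⁻ x, ((min (f x) n : NNReal) : ℝ≥0∞) ∂(ν : Measure α) := by
    rw [← lintegral_iSup (fun n ↦ by fun_prop)
      (fun m n hmn x ↦ by dsimp only; gcongr)]
    refine lintegral_congr fun x ↦ le_antisymm ?_ (iSup_le fun n ↦ by gcongr; exact min_le_left _ _)
    obtain ⟨n, hn⟩ := exists_nat_ge (f x)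
    exact le_iSup_of_le n (by rw [min_eq_left hn])
  simp_rw [key]
  refine lowerSemicontinuous_iSup fun n ↦ Continuous.lowerSemicontinuous ?_
  have hb : ∀ x y, dist (min (f x) (n : NNReal)) (min (f y) n) ≤ n := fun x y ↦ by
    rw [NNReal.dist_eq, abs_sub_le_iff]
    have h₁ : ((min (f x) (n : NNReal) : NNReal) : ℝ) ≤ n := by exact_mod_cast min_le_right _ _
    have h₂ : ((min (f y) (n : NNReal) : NNReal) : ℝ) ≤ n := by exact_mod_cast min_le_right _ _
    have h₃ := (min (f x) (n : NNReal)).coe_nonneg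
    have h₄ := (min (f y) (n : NNReal)).coe_nonneg
    constructor <;> linarith
  let g : BoundedContinuousFunction α NNReal :=
    BoundedContinuousFunction.mkOfBound ⟨fun x ↦ min (f x) n, by fun_prop⟩ n hb
  rw [continuous_iff_continuousAt]
  intro ν
  exact ProbabilityMeasure.tendsto_iff_forall_lintegral_tendsto.1 Filter.tendsto_id g

end MeasureTheory

/-! ### Wasserstein distance: optimal couplings and triangle inequality -/

namespace DistortionPerception

variable {n : ℕ} {μ γ : Measure (Vec n)}

lemma W2_le_eLpNorm_of_mem_couplings {ν : Measure (Vec n × Vec n)} (hν : ν ∈ couplings μ γ) :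
    W2 μ γ ≤ eLpNorm (fun z ↦ z.1 - z.2) 2 ν := by
  rw [eLpNorm_two_eq_lintegral_sq_rpow, W2]
  gcongr
  exact iInf₂_le ν hν

lemma W2_map_le_eLpNorm {α : Type*} {mα : MeasurableSpace α} {τ : Measure α}
    [IsProbabilityMeasure τ] {U V : α → Vec n} (hU : Measurable U) (hV : Measurable V) :
    W2 (τ.map U) (τ.map V) ≤ eLpNorm (U - V) 2 τ := by
  have hUV : Measurable fun a ↦ (U a, V a) := hU.prodMk hV
  have hmem : τ.map (fun a ↦ (U a, V a)) ∈ couplings (τ.map U) (τ.map V) :=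
    ⟨Measure.isProbabilityMeasure_map hUV.aemeasurable, Measure.fst_map_prodMk hV,
      Measure.snd_map_prodMk hU⟩
  refine (W2_le_eLpNorm_of_mem_couplings hmem).trans_eq ?_
  rw [eLpNorm_map_measure (by fun_prop) hUV.aemeasurable]
  rfl

lemma W2_map_le_eLpNorm_add {α : Type*} {mα : MeasurableSpace α} {τ : Measure α}
    [IsProbabilityMeasure τ] {U V W : α → Vec n} (hU : Measurable U) (hV : Measurable V)
    (hW : Measurable W) :
    W2 (τ.map U) (τ.map W) ≤ eLpNorm (U - V) 2 τ + eLpNorm (V - W) 2 τ := by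
  refine (W2_map_le_eLpNorm hU hW).trans ?_
  rw [← sub_add_sub_cancel U V W]
  exact eLpNorm_add_le (by fun_prop) (by fun_prop) (by norm_num)

lemma couplings_swap {ν : Measure (Vec n × Vec n)} (hν : ν ∈ couplings μ γ) :
    ν.map Prod.swap ∈ couplings γ μ := by
  obtain ⟨_, h₁, h₂⟩ := hν
  exact ⟨Measure.isProbabilityMeasure_map (by fun_prop), by simpa, by simpa⟩

lemma W2_comm_le : W2 μ γ ≤ W2 γ μ := by
  refine ENNReal.rpow_le_rpow (le_iInf₂ fun ν hν ↦ ?_) (by norm_num)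
  calc ⨅ ν ∈ couplings μ γ, ∫⁻ z, ‖z.1 - z.2‖ₑ ^ 2 ∂ν
      ≤ ∫⁻ z, ‖z.1 - z.2‖ₑ ^ 2 ∂(ν.map Prod.swap) := iInf₂_le _ (couplings_swap hν)
    _ = ∫⁻ z, ‖z.1 - z.2‖ₑ ^ 2 ∂ν := by
      rw [lintegral_map (by fun_prop) (by fun_prop)]
      simp [enorm_sub_rev]

lemma W2_comm : W2 μ γ = W2 γ μ := le_antisymm W2_comm_le W2_comm_le

/-- The couplings of two laws are tight. -/
lemma isTightMeasureSet_couplings [IsProbabilityMeasure μ] [IsProbabilityMeasure γ] :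
    IsTightMeasureSet (couplings μ γ) := by
  rw [isTightMeasureSet_iff_exists_isCompact_measure_compl_le]
  intro ε hε
  have hε' : 0 < ε / 2 := ENNReal.half_pos hε.ne'
  obtain ⟨K, hK, hKμ⟩ := isTightMeasureSet_iff_exists_isCompact_measure_compl_le.1
    (isTightMeasureSet_singleton (μ := μ)) _ hε'
  obtain ⟨L, hL, hLγ⟩ := isTightMeasureSet_iff_exists_isCompact_measure_compl_le.1
    (isTightMeasureSet_singleton (μ := γ)) _ hε'
  refine ⟨K ×ˢ L, hK.prod hL, ?_⟩
  rintro ν ⟨_, rfl, rfl⟩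
  rw [Set.compl_prod_eq_union]
  refine (measure_union_le _ _).trans ((add_le_add ?_ ?_).trans_eq (ENNReal.add_halves ε))
  · rw [Set.prod_univ, ← Measure.fst_apply hK.measurableSet.compl]
    exact hKμ _ rfl
  · rw [Set.univ_prod, ← Measure.snd_apply hL.measurableSet.compl]
    exact hLγ _ rfl

/-- Prokhorov's theorem applies by tightness; closedness holds because marginals depend continuously
on the coupling. -/
lemma isCompact_setOf_mem_couplings [IsProbabilityMeasure μ] [IsProbabilityMeasure γ] :
    IsCompact {ν : ProbabilityMeasure (Vec n × Vec n) | (ν : Measure _) ∈ couplings μ γ} := by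
  have hclosed : IsClosed
      {ν : ProbabilityMeasure (Vec n × Vec n) | (ν : Measure _) ∈ couplings μ γ} := by
    have heq : {ν : ProbabilityMeasure (Vec n × Vec n) | (ν : Measure _) ∈ couplings μ γ} =
        {ν | ν.map measurable_fst.aemeasurable = ⟨μ, inferInstance⟩} ∩
        {ν | ν.map measurable_snd.aemeasurable = ⟨γ, inferInstance⟩} := by
      ext ν
      refine ⟨fun h ↦ ⟨Subtype.ext h.2.1, Subtype.ext h.2.2⟩, fun h ↦ ⟨inferInstance, ?_, ?_⟩⟩
      · exact congrArg Subtype.val h.1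
      · exact congrArg Subtype.val h.2
    rw [heq]
    exact (isClosed_eq (ProbabilityMeasure.continuous_map continuous_fst) continuous_const).inter
      (isClosed_eq (ProbabilityMeasure.continuous_map continuous_snd) continuous_const)
  rw [← hclosed.closure_eq]
  apply isCompact_closure_of_isTightMeasureSet
  refine IsTightMeasureSet.subset (isTightMeasureSet_couplings (μ := μ) (γ := γ)) ?_
  rintro _ ⟨ν, hν, rfl⟩
  exact hν

/-- The infimum that defines the Wasserstein distance is attained. -/
lemma exists_mem_couplings_eLpNorm_eq_W2 (μ γ : Measure (Vec n)) [IsProbabilityMeasure μ]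
    [IsProbabilityMeasure γ] :
    ∃ ν ∈ couplings μ γ, eLpNorm (fun z ↦ z.1 - z.2) 2 ν = W2 μ γ := by
  have hne : {ν : ProbabilityMeasure (Vec n × Vec n) |
      (ν : Measure _) ∈ couplings μ γ}.Nonempty :=
    ⟨⟨μ.prod γ, inferInstance⟩, inferInstanceAs (IsProbabilityMeasure (μ.prod γ)), by simp, by simp⟩
  obtain ⟨ν, hν, hmin⟩ := LowerSemicontinuousOn.exists_isMinOn hne
    (isCompact_setOf_mem_couplings (μ := μ) (γ := γ))
    ((ProbabilityMeasure.lowerSemicontinuous_lintegral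
      (f := fun z : Vec n × Vec n ↦ ‖z.1 - z.2‖₊ ^ 2) (by fun_prop)).lowerSemicontinuousOn _)
  refine ⟨ν, hν, le_antisymm ?_ (W2_le_eLpNorm_of_mem_couplings hν)⟩
  rw [eLpNorm_two_eq_lintegral_sq_rpow, W2]
  gcongr
  refine le_iInf₂ fun ν' hν' ↦ ?_
  have := isMinOn_iff.1 hmin ⟨ν', hν'.1⟩ hν'
  simpa [enorm_eq_nnnorm] using this

/-- Gluing of two measures along a common marginal. -/
lemma exists_gluing (ν₁ ν₂ : Measure (Vec n × Vec n)) [IsProbabilityMeasure ν₁]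
    [IsProbabilityMeasure ν₂] (h : ν₁.snd = ν₂.fst) :
    ∃ τ : Measure ((Vec n × Vec n) × Vec n), IsProbabilityMeasure τ ∧
      τ.map Prod.fst = ν₁ ∧ τ.map (fun z ↦ (z.1.2, z.2)) = ν₂ := by
  refine ⟨ν₁ ⊗ₘ ν₂.condKernel.comap Prod.snd measurable_snd, inferInstance,
    Measure.fst_compProd _ _, ?_⟩
  -- The third coordinate is drawn from `ν₂` conditioned on the second coordinate alone.
  refine (Measure.map_prodMap_compProd_comap ν₁ measurable_snd ν₂.condKernel).trans ?_
  rw [← Measure.snd, h, Measure.disintegrate]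

/-- Glue optimal couplings along `η` and apply Minkowski's inequality in `L²` of the glued law. -/
lemma W2_triangle (μ η γ : Measure (Vec n)) [IsProbabilityMeasure μ] [IsProbabilityMeasure η]
    [IsProbabilityMeasure γ] : W2 μ γ ≤ W2 μ η + W2 η γ := by
  obtain ⟨ν₁, ⟨_, hfst₁, hsnd₁⟩, hν₁⟩ := exists_mem_couplings_eLpNorm_eq_W2 μ η
  obtain ⟨ν₂, ⟨_, hfst₂, hsnd₂⟩, hν₂⟩ := exists_mem_couplings_eLpNorm_eq_W2 η γ
  obtain ⟨τ, _, hτ₁, hτ₂⟩ := exists_gluing ν₁ ν₂ (hsnd₁.trans hfst₂.symm)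
  have hm : Measurable fun z : (Vec n × Vec n) × Vec n ↦ (z.1.2, z.2) := by fun_prop
  have hsub (ν : Measure (Vec n × Vec n)) :
      AEStronglyMeasurable (fun z : Vec n × Vec n ↦ z.1 - z.2) ν := by fun_prop
  have key := W2_map_le_eLpNorm_add (τ := τ) (U := fun z ↦ z.1.1) (V := fun z ↦ z.1.2)
    (W := fun z ↦ z.2) (by fun_prop) (by fun_prop) (by fun_prop)
  rw [← hν₁, ← hν₂, ← hfst₁, ← hsnd₂, ← hτ₁, ← hτ₂,
    eLpNorm_map_measure (hsub _) measurable_fst.aemeasurable,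
    eLpNorm_map_measure (hsub _) hm.aemeasurable, Measure.fst, Measure.snd,
    Measure.map_map measurable_fst measurable_fst, Measure.map_map measurable_snd hm]
  simp only [Function.comp_def, Pi.sub_def] at key ⊢
  exact key

end DistortionPerception

/-! ### Orthogonality in `L²` -/

namespace MeasureTheory

/-- The error of the conditional expectation is orthogonal to the observed variables. -/
lemma integral_inner_sub_condExp_eq_zero {Ω E : Type*} {m mΩ : MeasurableSpace Ω}
    {μ : Measure Ω} [IsFiniteMeasure μ] [NormedAddCommGroup E] [InnerProductSpace ℝ E]
    [CompleteSpace E] (hm : m ≤ mΩ) {f h : Ω → E} (hf : Integrable f μ)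
    (hh : StronglyMeasurable[m] h)
    (hfh : Integrable (fun ω ↦ inner ℝ (f ω - (μ[f | m]) ω) (h ω)) μ) :
    ∫ ω, inner ℝ (f ω - (μ[f | m]) ω) (h ω) ∂μ = 0 := by
  have hint : Integrable (fun ω ↦ f ω - (μ[f | m]) ω) μ := hf.sub integrable_condExp
  -- Conditionally on `m`, `h` comes out of the inner product, leaving the conditional mean of the
  -- error, which is zero.
  have hpull := condExp_bilin_of_stronglyMeasurable_right (innerSL ℝ) hh hfh hint
  have hzero : μ[fun ω ↦ f ω - (μ[f | m]) ω | m] =ᵐ[μ] 0 := by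
    refine (condExp_sub hf integrable_condExp m).trans ?_
    rw [condExp_of_stronglyMeasurable hm stronglyMeasurable_condExp integrable_condExp, sub_self]
  rw [← integral_condExp hm]
  refine integral_eq_zero_of_ae (hpull.trans ?_)
  filter_upwards [hzero] with ω hω
  simp [hω]

lemma MemLp.lintegral_sq_enorm_ne_top {α E : Type*} {mα : MeasurableSpace α}
    [NormedAddCommGroup E] {μ : Measure α} {f : α → E} (hf : MemLp f 2 μ) :
    ∫⁻ x, ‖f x‖ₑ ^ 2 ∂μ ≠ ∞ := by
  rw [lintegral_sq_enorm_eq_eLpNorm_sq]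
  exact ENNReal.pow_ne_top hf.2.ne

lemma memLp_two_of_lintegral_sq_enorm_ne_top {α E : Type*} {mα : MeasurableSpace α}
    [NormedAddCommGroup E] {μ : Measure α} {f : α → E} (hf : AEStronglyMeasurable f μ)
    (h : ∫⁻ x, ‖f x‖ₑ ^ 2 ∂μ ≠ ∞) : MemLp f 2 μ := by
  refine ⟨hf, ?_⟩
  rw [eLpNorm_two_eq_lintegral_sq_rpow]
  exact ENNReal.rpow_lt_top_of_nonneg (by norm_num) h

lemma MemLp.integrable_inner_real {α E : Type*} {mα : MeasurableSpace α}
    [NormedAddCommGroup E] [InnerProductSpace ℝ E] {μ : Measure α} {f g : α → E}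
    (hf : MemLp f 2 μ) (hg : MemLp g 2 μ) : Integrable (fun x ↦ inner ℝ (f x) (g x)) μ :=
  (hf.norm.integrable_mul hg.norm).mono' (hf.1.inner hg.1)
    (.of_forall fun x ↦ norm_inner_le_norm (f x) (g x))

/-- Pythagoras in `L²`. -/
lemma lintegral_sq_enorm_add_of_integral_inner_eq_zero {α E : Type*} {mα : MeasurableSpace α}
    [NormedAddCommGroup E] [InnerProductSpace ℝ E] {μ : Measure α} {f g : α → E}
    (hf : MemLp f 2 μ) (hg : MemLp g 2 μ) (h : ∫ x, inner ℝ (f x) (g x) ∂μ = 0) :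
    ∫⁻ x, ‖f x + g x‖ₑ ^ 2 ∂μ = ∫⁻ x, ‖f x‖ₑ ^ 2 ∂μ + ∫⁻ x, ‖g x‖ₑ ^ 2 ∂μ := by
  have key {u : α → E} (hu : MemLp u 2 μ) :
      ∫⁻ x, ‖u x‖ₑ ^ 2 ∂μ = ENNReal.ofReal (∫ x, ‖u x‖ ^ 2 ∂μ) := by
    rw [ofReal_integral_eq_lintegral_ofReal (hu.integrable_norm_pow two_ne_zero)
      (.of_forall fun x ↦ by positivity)]
    refine lintegral_congr fun x ↦ ?_
    rw [ENNReal.ofReal_pow (norm_nonneg _), ofReal_norm]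
  have hfg' : MemLp (fun x ↦ f x + g x) 2 μ := hf.add hg
  rw [key hf, key hg, key hfg', ← ENNReal.ofReal_add (by positivity) (by positivity)]
  congr 1
  have hf2 : Integrable (fun x ↦ ‖f x‖ ^ 2) μ := hf.integrable_norm_pow two_ne_zero
  have hg2 : Integrable (fun x ↦ ‖g x‖ ^ 2) μ := hg.integrable_norm_pow two_ne_zero
  have hfg : Integrable (fun x ↦ inner ℝ (f x) (g x)) μ := hf.integrable_inner_real hg
  simp_rw [norm_add_sq_real]
  rw [integral_add (hf2.fun_add (hfg.const_mul 2)) hg2, integral_add hf2 (hfg.const_mul 2),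
    integral_const_mul, h]
  ring

end MeasureTheory

/-! ### Decomposition of the mean squared error -/

namespace DistortionPerception

variable {Ω : Type*} [MeasurableSpace Ω] {ρ : Measure Ω} {nx ny : ℕ} {X : Ω → Vec nx}
  {Y : Ω → Vec ny}

lemma exists_measurable_xStar_eq_comp (ρ : Measure Ω) (X : Ω → Vec nx) (Y : Ω → Vec ny) :
    ∃ g : Vec ny → Vec nx, Measurable g ∧ xStar ρ X Y = g ∘ Y := by
  obtain ⟨g, hg, h⟩ := StronglyMeasurable.exists_eq_measurable_comp
    (stronglyMeasurable_condExp (μ := ρ) (f := X) (m := MeasurableSpace.comap Y inferInstance))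
  exact ⟨g, hg.measurable, h⟩

variable [IsProbabilityMeasure ρ] {K : Kernel (Vec ny) (Vec nx)} [IsMarkovKernel K]

lemma map_snd_jointLaw (hX : Measurable X) (hY : Measurable Y) :
    (jointLaw ρ X Y K).map (fun z ↦ (z.1.2, z.2)) = ρ.map Y ⊗ₘ K := by
  refine (Measure.map_prodMap_compProd_comap _ measurable_snd K).trans ?_
  rw [Measure.map_map measurable_snd (hX.prodMk hY)]
  rfl

lemma map_fst_jointLaw (hX : Measurable X) (hY : Measurable Y) :
    (jointLaw ρ X Y K).map Prod.fst = ρ.map (fun ω ↦ (X ω, Y ω)) := by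
  have := Measure.isProbabilityMeasure_map (μ := ρ) (hX.prodMk hY).aemeasurable
  exact Measure.fst_compProd _ _

/-- The error `X - E[X | Y]` is orthogonal to every function of `Y` and `X̂`. -/
lemma integral_inner_jointLaw_eq_zero (hX : Measurable X) (hY : Measurable Y)
    (hXint : Integrable X ρ) {g : Vec ny → Vec nx}
    (hgY : xStar ρ X Y = g ∘ Y) {b : Vec ny × Vec nx → Vec nx} (hb : Measurable b)
    (hbint : Integrable b (ρ.map Y ⊗ₘ K))
    (hint : Integrable (fun z ↦ inner ℝ (z.1.1 - g z.1.2) (b (z.1.2, z.2))) (jointLaw ρ X Y K)) :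
    ∫ z, inner ℝ (z.1.1 - g z.1.2) (b (z.1.2, z.2)) ∂(jointLaw ρ X Y K) = 0 := by
  have hXY : Measurable fun ω ↦ (X ω, Y ω) := hX.prodMk hY
  have := Measure.isProbabilityMeasure_map (μ := ρ) hXY.aemeasurable
  have := Measure.isProbabilityMeasure_map (μ := ρ) hY.aemeasurable
  -- Conditional independence enters here: averaging over `X̂` first replaces `b` by a function of
  -- `Y` alone, to which the orthogonality of conditional expectation applies.
  let B : Vec ny → Vec nx := fun y ↦ ∫ u, b (y, u) ∂(K y)
  have hB : StronglyMeasurable B := by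
    have : StronglyMeasurable (Function.uncurry fun y u ↦ b (y, u)) := hb.stronglyMeasurable
    exact this.integral_kernel_prod_right
  have hae : ∀ᵐ p ∂(ρ.map fun ω ↦ (X ω, Y ω)),
      ∫ u, inner ℝ (p.1 - g p.2) (b (p.2, u)) ∂(K p.2) = inner ℝ (p.1 - g p.2) (B p.2) := by
    have h₁ : ∀ᵐ y ∂(ρ.map Y), Integrable (fun u ↦ b (y, u)) (K y) :=
      ((Measure.integrable_compProd_iff hbint.1).1 hbint).1
    have h₂ : (ρ.map fun ω ↦ (X ω, Y ω)).map Prod.snd = ρ.map Y :=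
      Measure.map_map measurable_snd hXY
    rw [← h₂] at h₁
    filter_upwards [ae_of_ae_map measurable_snd.aemeasurable h₁] with p hp
    exact integral_inner hp _
  have hint' : Integrable (fun p : Vec nx × Vec ny ↦ inner ℝ (p.1 - g p.2) (B p.2))
      (ρ.map fun ω ↦ (X ω, Y ω)) := by
    refine Integrable.congr ?_ hae
    rw [jointLaw, Measure.compProd] at hint
    simpa using hint.integral_compProd
  rw [jointLaw, Measure.integral_compProd hint]
  calc _ = ∫ p, inner ℝ (p.1 - g p.2) (B p.2) ∂(ρ.map fun ω ↦ (X ω, Y ω)) := integral_congr_ae hae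
    _ = ∫ ω, inner ℝ (X ω - xStar ρ X Y ω) (B (Y ω)) ∂ρ := by
      rw [integral_map hXY.aemeasurable hint'.1, hgY]
      rfl
    _ = 0 := by
      refine integral_inner_sub_condExp_eq_zero hY.comap_le hXint
        (hB.comp_measurable (comap_measurable Y)) ?_
      rw [← xStar, hgY]
      exact (integrable_map_measure hint'.1 hXY.aemeasurable).1 hint'

/-- Pythagoras for `X - X̂ = (X - X*) + (X* - X̂)`. -/
lemma mse_eq_dStar_add (hX : Measurable X) (hY : Measurable Y) (hX2 : MemLp X 2 ρ)
    {g : Vec ny → Vec nx} (hg : Measurable g) (hgY : xStar ρ X Y = g ∘ Y) :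
    mse ρ X Y K = dStar ρ X Y + ∫⁻ z, ‖g z.1 - z.2‖ₑ ^ 2 ∂(ρ.map Y ⊗ₘ K) := by
  have hXY : Measurable fun ω ↦ (X ω, Y ω) := hX.prodMk hY
  have := Measure.isProbabilityMeasure_map (μ := ρ) hXY.aemeasurable
  have := Measure.isProbabilityMeasure_map (μ := ρ) hY.aemeasurable
  have hprob : IsProbabilityMeasure (jointLaw ρ X Y K) := by unfold jointLaw; infer_instance
  have hp : Measurable fun z : (Vec nx × Vec ny) × Vec nx ↦ (z.1.2, z.2) := by fun_prop
  have hD : dStar ρ X Y = ∫⁻ z, ‖z.1.1 - g z.1.2‖ₑ ^ 2 ∂(jointLaw ρ X Y K) := by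
    calc dStar ρ X Y = ∫⁻ p, ‖p.1 - g p.2‖ₑ ^ 2 ∂(ρ.map fun ω ↦ (X ω, Y ω)) := by
          rw [lintegral_map (by fun_prop) hXY, dStar, hgY]
          rfl
      _ = _ := by
          rw [← map_fst_jointLaw (K := K) hX hY, lintegral_map (by fun_prop) measurable_fst]
  have hdfin : dStar ρ X Y ≠ ∞ := (hX2.sub (hX2.condExp one_le_two)).lintegral_sq_enorm_ne_top
  have hb : ∫⁻ z, ‖g z.1 - z.2‖ₑ ^ 2 ∂(ρ.map Y ⊗ₘ K) =
      ∫⁻ z, ‖g z.1.2 - z.2‖ₑ ^ 2 ∂(jointLaw ρ X Y K) := by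
    rw [← map_snd_jointLaw hX hY, lintegral_map (by fun_prop) hp]
  have ha2 : MemLp (fun z ↦ z.1.1 - g z.1.2) 2 (jointLaw ρ X Y K) :=
    memLp_two_of_lintegral_sq_enorm_ne_top (by fun_prop) (hD ▸ hdfin)
  -- Square-integrability of `X̂` is not assumed. If the last term is infinite, so is the
  -- distortion, since `X* - X̂ = (X - X̂) - (X - X*)` and `X - X*` is in `L²`.
  by_cases hfin : ∫⁻ z, ‖g z.1 - z.2‖ₑ ^ 2 ∂(ρ.map Y ⊗ₘ K) = ∞
  · rw [hfin, add_top]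
    by_contra hmse
    have h₁ : MemLp (fun z ↦ z.1.1 - z.2) 2 (jointLaw ρ X Y K) :=
      memLp_two_of_lintegral_sq_enorm_ne_top (by fun_prop) hmse
    refine (h₁.sub ha2).lintegral_sq_enorm_ne_top ?_
    simpa [← hb] using hfin
  · have hb2' : MemLp (fun z ↦ g z.1 - z.2) 2 (ρ.map Y ⊗ₘ K) :=
      memLp_two_of_lintegral_sq_enorm_ne_top (by fun_prop) hfin
    have hb2 : MemLp (fun z ↦ g z.1.2 - z.2) 2 (jointLaw ρ X Y K) :=
      memLp_two_of_lintegral_sq_enorm_ne_top (by fun_prop) (hb ▸ hfin)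
    rw [hD, hb, ← lintegral_sq_enorm_add_of_integral_inner_eq_zero ha2 hb2]
    · simp [mse]
    · exact integral_inner_jointLaw_eq_zero hX hY (hX2.integrable one_le_two) hgY
        (b := fun z ↦ g z.1 - z.2) (by fun_prop) (hb2'.integrable one_le_two)
        (ha2.integrable_inner_real hb2)

end DistortionPerception

/-! ### The optimal estimator and the two bounds -/

namespace DistortionPerception

/-- Moving a fraction `s` of the way along an optimal coupling from `γ` to `μ`. -/
lemma exists_kernel_interpolation {n : ℕ} (μ γ : Measure (Vec n)) [IsProbabilityMeasure μ]
    [IsProbabilityMeasure γ] (hfin : W2 μ γ ≠ ∞) {s : ℝ} (hs₀ : 0 ≤ s) (hs₁ : s ≤ 1) :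
    ∃ κ : Kernel (Vec n) (Vec n), IsMarkovKernel κ ∧
      eLpNorm (fun z ↦ z.1 - z.2) 2 (γ ⊗ₘ κ) = ENNReal.ofReal s * W2 μ γ ∧
      W2 μ (κ ∘ₘ γ) = ENNReal.ofReal (1 - s) * W2 μ γ := by
  obtain ⟨ν, ⟨_, hfst, hsnd⟩, hν⟩ := exists_mem_couplings_eLpNorm_eq_W2 γ μ
  rw [W2_comm] at hν
  let f : Vec n × Vec n → Vec n := fun z ↦ z.1 + s • (z.2 - z.1)
  have hf : Measurable f := by fun_prop
  -- From `x`, draw `x'` from the optimal coupling conditioned on `x`, then output `x + s(x' - x)`.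
  let κ : Kernel (Vec n) (Vec n) := (Kernel.id ×ₖ ν.condKernel).map f
  have hκ : IsMarkovKernel κ := Kernel.IsMarkovKernel.map _ hf
  have hlaw : γ ⊗ₘ κ = ν.map fun z ↦ (z.1, f z) := by
    refine Measure.ext_of_lintegral _ fun h hh ↦ ?_
    rw [lintegral_map hh (by fun_prop), Measure.lintegral_compProd hh]
    conv_rhs => rw [← ν.disintegrate ν.condKernel, hfst]
    rw [Measure.lintegral_compProd (by fun_prop)]
    refine lintegral_congr fun x ↦ ?_
    rw [Kernel.lintegral_map _ hf _ (by fun_prop), Kernel.lintegral_id_prod (by fun_prop)]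
  have hlaw_snd : κ ∘ₘ γ = ν.map f := by
    rw [← Measure.snd_compProd, hlaw, Measure.snd_map_prodMk measurable_fst]
  have hfst_sub : eLpNorm (Prod.fst - f) 2 ν = ENNReal.ofReal s * W2 μ γ := by
    have : (Prod.fst - f) = s • fun z : Vec n × Vec n ↦ z.1 - z.2 := by
      ext1 z
      simp only [Pi.sub_apply, Pi.smul_apply, f]
      module
    rw [this, eLpNorm_const_smul, hν, Real.enorm_of_nonneg hs₀]
  have hsnd_sub : eLpNorm (Prod.snd - f) 2 ν = ENNReal.ofReal (1 - s) * W2 μ γ := by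
    have : (Prod.snd - f) = (-(1 - s)) • fun z : Vec n × Vec n ↦ z.1 - z.2 := by
      ext1 z
      simp only [Pi.sub_apply, Pi.smul_apply, f]
      module
    rw [this, eLpNorm_const_smul, hν, enorm_neg, Real.enorm_of_nonneg (by linarith)]
  refine ⟨κ, hκ, ?_, le_antisymm ?_ ?_⟩
  · rw [← hfst_sub, hlaw, eLpNorm_map_measure (by fun_prop) (by fun_prop)]
    rfl
  · rw [hlaw_snd, ← hsnd_sub, ← hsnd]
    exact W2_map_le_eLpNorm measurable_snd hf
  -- The interpolated law is within `s W₂(μ, γ)` of `γ`, so the triangle inequality forces it to be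
  -- at least `(1 - s) W₂(μ, γ)` from `μ`; finiteness permits the cancellation.
  · have hle : W2 (κ ∘ₘ γ) γ ≤ ENNReal.ofReal s * W2 μ γ := by
      rw [W2_comm, hlaw_snd, ← hfst_sub, ← hfst]
      exact W2_map_le_eLpNorm measurable_fst hf
    refine ENNReal.le_of_add_le_add_right
      (ENNReal.mul_ne_top (ENNReal.ofReal_ne_top (r := s)) hfin) ?_
    rw [← add_mul, ← ENNReal.ofReal_add (by linarith) hs₀]
    simpa using (W2_triangle μ (κ ∘ₘ γ) γ).trans (add_le_add_right hle _)

lemma exists_fraction (p P : ℝ) (hp : 0 ≤ p) (hP : 0 ≤ P) :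
    ∃ s : ℝ, 0 ≤ s ∧ s ≤ 1 ∧ s * p = max 0 (p - P) ∧ (1 - s) * p = min P p := by
  have hle : max 0 (p - P) ≤ p := max_le hp (by linarith)
  -- When `p = 0` the numerator vanishes too, so division by zero is harmless.
  have hsp : max 0 (p - P) / p * p = max 0 (p - P) :=
    div_mul_cancel_of_imp fun h ↦ le_antisymm (hle.trans_eq h) (le_max_left _ _)
  refine ⟨max 0 (p - P) / p, by positivity, div_le_one_of_le₀ hle hp, hsp, ?_⟩
  rw [sub_mul, hsp, one_mul]
  rcases le_total P p with h | h
  · rw [max_eq_right (by linarith), min_eq_left h]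
    ring
  · rw [max_eq_left (by linarith), min_eq_right h]
    ring

variable {Ω : Type*} [MeasurableSpace Ω] {ρ : Measure Ω} {nx ny : ℕ}
  {X : Ω → Vec nx} {Y : Ω → Vec ny}

lemma memLp_xStar (hX2 : MemLp X 2 ρ) : MemLp (xStar ρ X Y) 2 ρ := hX2.condExp one_le_two

lemma dStar_ne_top (hX2 : MemLp X 2 ρ) : dStar ρ X Y ≠ ∞ :=
  (hX2.sub (memLp_xStar hX2)).lintegral_sq_enorm_ne_top

lemma measurable_xStar (hY : Measurable Y) : Measurable (xStar ρ X Y) := by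
  obtain ⟨g, hg, hgY⟩ := exists_measurable_xStar_eq_comp ρ X Y
  rw [hgY]
  exact hg.comp hY

variable [IsProbabilityMeasure ρ]

lemma pStar_ne_top (hX : Measurable X) (hY : Measurable Y) (hX2 : MemLp X 2 ρ) :
    pStar ρ X Y ≠ ∞ :=
  ne_top_of_le_ne_top (hX2.sub (memLp_xStar hX2)).2.ne
    (W2_map_le_eLpNorm hX (measurable_xStar hY))

/-- The joint law of `(Y, X̂)` couples `X* = g(Y)` with `X̂`; the triangle inequality passes through
the law of `X̂`. Truncated subtraction supplies the positive part. -/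
lemma dStar_add_sq_le_mse (hX : Measurable X) (hY : Measurable Y) (hX2 : MemLp X 2 ρ)
    (K : Kernel (Vec ny) (Vec nx)) [IsMarkovKernel K] :
    dStar ρ X Y + (pStar ρ X Y - perceptionIndex ρ X Y K) ^ 2 ≤ mse ρ X Y K := by
  obtain ⟨g, hg, hgY⟩ := exists_measurable_xStar_eq_comp ρ X Y
  have := Measure.isProbabilityMeasure_map (μ := ρ) hX.aemeasurable
  have := Measure.isProbabilityMeasure_map (μ := ρ) hY.aemeasurable
  have hZ : ρ.map (xStar ρ X Y) = (ρ.map Y ⊗ₘ K).map fun z ↦ g z.1 := by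
    rw [hgY, ← Measure.map_map hg hY]
    nth_rw 1 [← Measure.fst_compProd (ρ.map Y) K]
    exact Measure.map_map hg measurable_fst
  have := Measure.isProbabilityMeasure_map (μ := ρ)
    (measurable_xStar (X := X) (ρ := ρ) hY).aemeasurable
  rw [mse_eq_dStar_add hX hY hX2 hg hgY, lintegral_sq_enorm_eq_eLpNorm_sq]
  gcongr
  rw [tsub_le_iff_left]
  refine (W2_triangle _ (K ∘ₘ ρ.map Y) _).trans (add_le_add_right ?_ _)
  rw [W2_comm, hZ, ← Measure.snd_compProd]
  exact W2_map_le_eLpNorm (by fun_prop) measurable_snd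

/-- Apply the interpolating kernel to `X* = g(Y)`, that is, pull it back along `g`. -/
lemma exists_estimator_of_xStar (hX : Measurable X) (hY : Measurable Y) (hX2 : MemLp X 2 ρ)
    {P : ℝ} (hP : 0 ≤ P) :
    ∃ (κ : Kernel (Vec nx) (Vec nx)) (K : Kernel (Vec ny) (Vec nx)),
      IsMarkovKernel κ ∧ IsMarkovKernel K ∧ (∀ ω, K (Y ω) = κ (xStar ρ X Y ω)) ∧
      perceptionIndex ρ X Y K = min (ENNReal.ofReal P) (pStar ρ X Y) ∧
      mse ρ X Y K = dStar ρ X Y + (pStar ρ X Y - ENNReal.ofReal P) ^ 2 := by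
  obtain ⟨g, hg, hgY⟩ := exists_measurable_xStar_eq_comp ρ X Y
  have := Measure.isProbabilityMeasure_map (μ := ρ) hX.aemeasurable
  have := Measure.isProbabilityMeasure_map (μ := ρ) hY.aemeasurable
  have := Measure.isProbabilityMeasure_map (μ := ρ)
    (measurable_xStar (X := X) (ρ := ρ) hY).aemeasurable
  have hfin : pStar ρ X Y ≠ ∞ := pStar_ne_top hX hY hX2
  obtain ⟨s, hs₀, hs₁, hs, hs'⟩ :=
    exists_fraction (pStar ρ X Y).toReal P ENNReal.toReal_nonneg hP
  have hmul {t : ℝ} (ht : 0 ≤ t) :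
      ENNReal.ofReal t * pStar ρ X Y = ENNReal.ofReal (t * (pStar ρ X Y).toReal) := by
    rw [ENNReal.ofReal_mul ht, ENNReal.ofReal_toReal hfin]
  obtain ⟨κ, hκ, hκ₁, hκ₂⟩ :=
    exists_kernel_interpolation (ρ.map X) (ρ.map (xStar ρ X Y)) hfin hs₀ hs₁
  have hlaw : (ρ.map Y ⊗ₘ κ.comap g hg).map (Prod.map g id) = ρ.map (xStar ρ X Y) ⊗ₘ κ := by
    rw [Measure.map_prodMap_compProd_comap, Measure.map_map hg hY, hgY]
  have hcomp : κ.comap g hg ∘ₘ ρ.map Y = κ ∘ₘ ρ.map (xStar ρ X Y) := by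
    rw [← Measure.snd_compProd, ← Measure.snd_compProd, ← hlaw, Measure.snd, Measure.snd,
      Measure.map_map measurable_snd (by fun_prop)]
    rfl
  refine ⟨κ, κ.comap g hg, hκ, inferInstance, fun ω ↦ ?_, ?_, ?_⟩
  · rw [Kernel.comap_apply, hgY]
    rfl
  · rw [perceptionIndex, hcomp, hκ₂]
    refine (hmul (by linarith)).trans ?_
    rw [hs', ENNReal.ofReal_min, ENNReal.ofReal_toReal hfin]
  · rw [mse_eq_dStar_add hX hY hX2 hg hgY]
    congr 1
    calc ∫⁻ z, ‖g z.1 - z.2‖ₑ ^ 2 ∂(ρ.map Y ⊗ₘ κ.comap g hg)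
        = ∫⁻ z, ‖z.1 - z.2‖ₑ ^ 2 ∂(ρ.map (xStar ρ X Y) ⊗ₘ κ) := by
          rw [← hlaw, lintegral_map (by fun_prop) (by fun_prop)]
          rfl
      _ = (ENNReal.ofReal s * pStar ρ X Y) ^ 2 := by
          rw [lintegral_sq_enorm_eq_eLpNorm_sq, hκ₁, pStar]
      _ = (pStar ρ X Y - ENNReal.ofReal P) ^ 2 := by
          rw [hmul hs₀, hs, ENNReal.ofReal_max, ENNReal.ofReal_zero, max_eq_right zero_le,
            ENNReal.ofReal_sub _ hP, ENNReal.ofReal_toReal hfin]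

lemma dpFunction_eq (hX : Measurable X) (hY : Measurable Y) (hX2 : MemLp X 2 ρ)
    {P : ℝ} (hP : 0 ≤ P) :
    dpFunction ρ X Y P = dStar ρ X Y + (pStar ρ X Y - ENNReal.ofReal P) ^ 2 := by
  refine le_antisymm ?_ (le_iInf fun K ↦ le_iInf fun _ ↦ le_iInf fun hK ↦ ?_)
  · obtain ⟨κ, K, -, hK, -, hperc, hmse⟩ := exists_estimator_of_xStar hX hY hX2 hP
    rw [← hmse]
    exact iInf_le_of_le K (iInf_le_of_le hK
      (iInf_le_of_le (hperc.trans_le (min_le_left _ _)) le_rfl))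
  · refine le_trans ?_ (dStar_add_sq_le_mse hX hY hX2 K)
    -- The lower bound decreases in the perception index, which is at most `P`.
    gcongr

end DistortionPerception

theorem theorem1 {Ω : Type*} [MeasurableSpace Ω] (ρ : Measure Ω) [IsProbabilityMeasure ρ]
    {nx ny : ℕ} (X : Ω → Vec nx) (Y : Ω → Vec ny) (hX : Measurable X) (hY : Measurable Y)
    (hX2 : MemLp X 2 ρ) (P : ℝ) (hP : 0 ≤ P) :
    dStar ρ X Y ≠ ∞ ∧ pStar ρ X Y ≠ ∞ ∧ dpFunction ρ X Y P ≠ ∞ ∧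
    (dpFunction ρ X Y P).toReal =
      (dStar ρ X Y).toReal + (max 0 ((pStar ρ X Y).toReal - P)) ^ 2 ∧
    ∃ (κ : Kernel (Vec nx) (Vec nx)) (K : Kernel (Vec ny) (Vec nx)),
      IsMarkovKernel κ ∧ IsMarkovKernel K ∧
      (∀ᵐ ω ∂ρ, K (Y ω) = κ (xStar ρ X Y ω)) ∧
      perceptionIndex ρ X Y K = min (ENNReal.ofReal P) (pStar ρ X Y) ∧
      mse ρ X Y K = dpFunction ρ X Y P := by
  have hd : dStar ρ X Y ≠ ∞ := dStar_ne_top hX2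
  have hp : pStar ρ X Y ≠ ∞ := pStar_ne_top hX hY hX2
  have hsq : (pStar ρ X Y - ENNReal.ofReal P) ^ 2 ≠ ∞ :=
    ENNReal.pow_ne_top (ENNReal.sub_ne_top hp)
  have hsub : (pStar ρ X Y - ENNReal.ofReal P).toReal = max 0 ((pStar ρ X Y).toReal - P) := by
    conv_lhs => rw [← ENNReal.ofReal_toReal hp]
    rw [← ENNReal.ofReal_sub _ hP, ENNReal.toReal_ofReal', max_comm]
  rw [dpFunction_eq hX hY hX2 hP]
  refine ⟨hd, hp, ENNReal.add_ne_top.2 ⟨hd, hsq⟩, ?_, ?_⟩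
  · rw [ENNReal.toReal_add hd hsq, ENNReal.toReal_pow, hsub]
  · obtain ⟨κ, K, hκ, hK, hKκ, hperc, hmse⟩ := exists_estimator_of_xStar hX hY hX2 hP
    exact ⟨κ, K, hκ, hK, .of_forall hKκ, hperc, hmse⟩
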